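/- Consider first-order formulae with equality over purely relational signatures. The guarded fragment $\mathrm{GF}$ is the smallest set of formulae that contains all atoms (relational atoms and equalities between variables), is closed under boolean connectives, and contains $\forall\bar y\,(\gamma(\bar x,\bar y)\to\psi(\bar x,\bar y))$ and $\exists\bar y\,(\gamma(\bar x,\bar y)\wedge\psi(\bar x,\bar y))$ whenever $\psi$ is in the set and $\gamma$ is an atom (equality allowed) containing all free variables of $\psi$. For a binary relation symbol $R$ and a rational $q\in[0,100]$, the local percentage quantifier has the semantics, over a finite structure $\mathfrak M$, \[\mathfrak M,x/a\models \exists^{=q\%}_{R}\,y\ \varphi(x,y)\iff |\{b : \mathfrak M\models R(a,b)\wedge\varphi(a,b)\}|=\tfrac{q}{100}\cdot|\{b : \mathfrak M\models R(a,b)\}| .\] The logic $\mathrm{GF}_{loc\%}$ is obtained by adding to the formation rules of $\mathrm{GF}$ the rule that $\exists^{=q\%}_{R}\,y\ \varphi(x,y)$ is a formula for every $\varphi\in\mathrm{GF}$ with free variables among the distinct variables $x,y$; $\mathrm{GF}^3_{loc\%}$ is its fragment in which only three variables are used (they may be requantified). Theorem. The finite satisfiability problem for $\mathrm{GF}_{loc\%}$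 (given a sentence, does it have a finite nonempty model?) is undecidable. It remains undecidable for sentences of $\mathrm{GF}^3_{loc\%}$ over signatures whose relation symbols have arity at most three. -/

import Mathlib

namespace PercLogic

open FirstOrder

/-- The relational vocabulary: countably many relation symbols `r : ℕ` of every arity, and no
constant or function symbols.  (Every formula uses only finitely many of the symbols.) -/
abbrev relLang : Language := ⟨fun _ => Empty, fun _ => ℕ⟩

/-- First-order formulae with equality over `relLang`, with variables named by natural numbers,
extended with the local percentage quantifiers.  The formula `perc q r x y φ` is
`∃^{=q%}_r y φ(x, y)`: exactly `q` percent of the `r`-successors `y` of `x` satisfy `φ`. -/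
inductive Formula : Type
  | eq (x y : ℕ) : Formula
  | rel {n : ℕ} (r : ℕ) (v : Fin n → ℕ) : Formula
  | neg (φ : Formula) : Formula
  | and (φ ψ : Formula) : Formula
  | or (φ ψ : Formula) : Formula
  | imp (φ ψ : Formula) : Formula
  | all (x : ℕ) (φ : Formula) : Formula
  | ex (x : ℕ) (φ : Formula) : Formula
  | perc (q : ℚ) (r x y : ℕ) (φ : Formula) : Formula

namespace Formula

/-- The block `∀ y₁ … ∀ yₘ φ`. -/
def allBlock (ys : List ℕ) (φ : Formula) : Formula := ys.foldr all φ

/-- The block `∃ y₁ … ∃ yₘ φ`. -/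
def exBlock (ys : List ℕ) (φ : Formula) : Formula := ys.foldr ex φ

/-- The free variables of a formula. -/
def free : Formula → Finset ℕ
  | eq x y => {x, y}
  | rel _ v => Finset.univ.image v
  | neg φ => φ.free
  | and φ ψ => φ.free ∪ ψ.free
  | or φ ψ => φ.free ∪ ψ.free
  | imp φ ψ => φ.free ∪ ψ.free
  | all x φ => φ.free.erase x
  | ex x φ => φ.free.erase x
  | perc _ _ x y φ => insert x (φ.free.erase y)

/-- All variables that occur in a formula, free or bound. -/
def vars : Formula → Finset ℕ
  | eq x y => {x, y}
  | rel _ v => Finset.univ.image v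
  | neg φ => φ.vars
  | and φ ψ => φ.vars ∪ ψ.vars
  | or φ ψ => φ.vars ∪ ψ.vars
  | imp φ ψ => φ.vars ∪ ψ.vars
  | all x φ => insert x φ.vars
  | ex x φ => insert x φ.vars
  | perc _ _ x y φ => insert x (insert y φ.vars)

/-- All relation symbols in the formula have arity at most `m`. -/
def ArityLE (m : ℕ) : Formula → Prop
  | eq _ _ => True
  | rel (n := n) _ _ => n ≤ m
  | neg φ => φ.ArityLE m
  | and φ ψ => φ.ArityLE m ∧ ψ.ArityLE m
  | or φ ψ => φ.ArityLE m ∧ ψ.ArityLE m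
  | imp φ ψ => φ.ArityLE m ∧ ψ.ArityLE m
  | all _ φ => φ.ArityLE m
  | ex _ φ => φ.ArityLE m
  | perc _ _ _ _ φ => 2 ≤ m ∧ φ.ArityLE m

/-- Satisfaction of a formula in a structure under an assignment of the variables
(the percentage quantifier is meant for finite structures). -/
def Sat {M : Type} [relLang.Structure M] : Formula → (ℕ → M) → Prop
  | eq x y, s => s x = s y
  | rel (n := n) r v, s => Language.Structure.RelMap (L := relLang) (n := n) r fun i => s (v i)
  | neg φ, s => ¬ φ.Sat s
  | and φ ψ, s => φ.Sat s ∧ ψ.Sat s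
  | or φ ψ, s => φ.Sat s ∨ ψ.Sat s
  | imp φ ψ, s => φ.Sat s → ψ.Sat s
  | all x φ, s => ∀ a : M, φ.Sat (Function.update s x a)
  | ex x φ, s => ∃ a : M, φ.Sat (Function.update s x a)
  | perc q r x y φ, s =>
      (({b : M | Language.Structure.RelMap (L := relLang) (n := 2) r ![s x, b] ∧
          φ.Sat (Function.update s y b)}.ncard : ℕ) : ℚ) =
        q / 100 *
          ({b : M | Language.Structure.RelMap (L := relLang) (n := 2) r ![s x, b]}.ncard : ℕ)

/-- The formula has a finite (nonempty) model. -/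
def FinSat (φ : Formula) : Prop :=
  ∃ (M : Type) (_ : Nonempty M) (_ : Finite M) (_ : relLang.Structure M),
    ∀ s : ℕ → M, φ.Sat s

/-- Atomic formulae: equalities and relational atoms. -/
def IsAtom : Formula → Prop
  | eq _ _ => True
  | rel _ _ => True
  | _ => False

/-- The guarded fragment. -/
inductive GF : Formula → Prop
  | atom {γ : Formula} : γ.IsAtom → GF γ
  | neg {φ : Formula} : GF φ → GF φ.neg
  | and {φ ψ : Formula} : GF φ → GF ψ → GF (φ.and ψ)
  | or {φ ψ : Formula} : GF φ → GF ψ → GF (φ.or ψ)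
  | imp {φ ψ : Formula} : GF φ → GF ψ → GF (φ.imp ψ)
  | all (ys : List ℕ) {γ ψ : Formula} : γ.IsAtom → ψ.free ⊆ γ.free → GF ψ →
      GF (allBlock ys (γ.imp ψ))
  | ex (ys : List ℕ) {γ ψ : Formula} : γ.IsAtom → ψ.free ⊆ γ.free → GF ψ →
      GF (exBlock ys (γ.and ψ))

/-- The guarded fragment with local percentage quantifiers: the rules of the guarded fragment
together with `∃^{=q%}_r y φ(x, y)` for `φ` in the guarded fragment with free variables among
`x, y`. -/
inductive GFLoc : Formula → Prop
  | atom {γ : Formula} : γ.IsAtom → GFLoc γ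
  | neg {φ : Formula} : GFLoc φ → GFLoc φ.neg
  | and {φ ψ : Formula} : GFLoc φ → GFLoc ψ → GFLoc (φ.and ψ)
  | or {φ ψ : Formula} : GFLoc φ → GFLoc ψ → GFLoc (φ.or ψ)
  | imp {φ ψ : Formula} : GFLoc φ → GFLoc ψ → GFLoc (φ.imp ψ)
  | all (ys : List ℕ) {γ ψ : Formula} : γ.IsAtom → ψ.free ⊆ γ.free → GFLoc ψ →
      GFLoc (allBlock ys (γ.imp ψ))
  | ex (ys : List ℕ) {γ ψ : Formula} : γ.IsAtom → ψ.free ⊆ γ.free → GFLoc ψ →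
      GFLoc (exBlock ys (γ.and ψ))
  | perc {q : ℚ} (r : ℕ) {x y : ℕ} {φ : Formula} : 0 ≤ q → q ≤ 100 → x ≠ y →
      φ.free ⊆ {x, y} → GF φ → GFLoc (perc q r x y φ)

/-- The Gödel number of a formula. -/
def code : Formula → ℕ
  | eq x y => Nat.pair 0 (Nat.pair x y)
  | rel r v => Nat.pair 1 (Nat.pair r (Encodable.encode (List.ofFn v)))
  | neg φ => Nat.pair 2 φ.code
  | and φ ψ => Nat.pair 3 (Nat.pair φ.code ψ.code)
  | or φ ψ => Nat.pair 4 (Nat.pair φ.code ψ.code)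
  | imp φ ψ => Nat.pair 5 (Nat.pair φ.code ψ.code)
  | all x φ => Nat.pair 6 (Nat.pair x φ.code)
  | ex x φ => Nat.pair 7 (Nat.pair x φ.code)
  | perc q r x y φ => Nat.pair 8 (Nat.pair (Nat.pair (Encodable.encode q.num) q.den)
      (Nat.pair r (Nat.pair x (Nat.pair y φ.code))))

/-- Different formulae have different Gödel numbers. -/
theorem code_injective : Function.Injective code := by
  intro φ
  induction φ with
  | eq x y => intro ψ h; cases ψ <;> simp_all [code, Nat.pair_eq_pair]
  | @rel n r v =>
    intro ψ h
    cases ψ with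
    | @rel m r' v' =>
      simp only [code, Nat.pair_eq_pair, true_and] at h
      obtain ⟨rfl, h⟩ := h
      have h := Encodable.encode_injective h
      have hn : n = m := by simpa using congrArg List.length h
      subst hn
      rw [List.ofFn_injective h]
    | _ => simp [code, Nat.pair_eq_pair] at h
  | neg φ ih =>
    intro ψ h
    cases ψ <;> simp [code, Nat.pair_eq_pair] at h
    rw [ih h]
  | and φ χ ih1 ih2 | or φ χ ih1 ih2 | imp φ χ ih1 ih2 =>
    intro ψ h
    cases ψ <;> simp [code, Nat.pair_eq_pair] at h
    rw [ih1 h.1, ih2 h.2]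
  | all x φ ih | ex x φ ih =>
    intro ψ h
    cases ψ <;> simp [code, Nat.pair_eq_pair] at h
    rw [h.1, ih h.2]
  | perc q r x y φ ih =>
    intro ψ h
    cases ψ <;> simp [code, Nat.pair_eq_pair] at h
    obtain ⟨⟨h1, h2⟩, rfl, rfl, rfl, h⟩ := h
    rw [ih h, Rat.ext h1 h2]

end Formula

/-- The sentences of the guarded fragment with local percentage quantifiers. -/
def GFLocSentences : Set Formula := {φ | φ.GFLoc ∧ φ.free = ∅}

/-- Its `k`-variable fragment: only the variables `0, …, k - 1` are used (but may be
requantified). -/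
def GFLocVarSentences (k : ℕ) : Set Formula :=
  {φ | φ ∈ GFLocSentences ∧ ∀ x ∈ φ.vars, x < k}

/-- The finite satisfiability problem for the formulae in `C` is decidable: some algorithm gives
the right answer on (the Gödel number of) every formula of `C`; its output on other inputs is
irrelevant. -/
def FinSatDecidable (C : Set Formula) : Prop :=
  ∃ f : ℕ → Bool, Computable f ∧ ∀ φ ∈ C, (f φ.code = true ↔ φ.FinSat)

end PercLogic

/-!
Halting of stack machines is reduced to finite satisfiability. The percentage quantifier makes
binary relations encode partial functions: if half of the `R`-successors of `x` are equal to `x`,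
then `x` has no `R`-successors, or exactly two, namely `x` itself and another point, which is the
value at `x`.

A model consists of configurations and stack cells. Every cell points to the one below it, and
every configuration to the top cells of its stacks; a push or pop moves such a pointer by one cell,
so two successive configurations share the unchanged part of their stacks, and equality of values
of partial functions is a guarded formula in three variables that transfers it. The function `step`
to the next configuration is injective, since `prev` inverts it, and misses the initial
configuration, where `prev` is undefined; hence in a finite model it cannot be iterated forever from
there, and the machine halts. Conversely, a halting run is a finite model.
-/

namespace PercLogic

section StackMachines

open StateTransition

theorem eval_dom_iff_exists_iterate {α : Type*} (f : α → Option α) (a : α) :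
    (eval f a).Dom ↔ ∃ n, f ((fun b => (f b).getD b)^[n] a) = none := by
  constructor
  · intro h
    obtain ⟨hr, hn⟩ := mem_eval.1 (Part.get_mem h)
    generalize (eval f a).get h = b at hr hn
    clear h
    induction hr using Relation.ReflTransGen.head_induction_on with
    | refl => exact ⟨0, hn⟩
    | head hac _ ih =>
      obtain ⟨n, hn⟩ := ih
      refine ⟨n + 1, ?_⟩
      rwa [Function.iterate_succ_apply, Option.mem_def.1 hac]
  · rintro ⟨n, hn⟩
    refine Part.dom_iff_mem.2 ⟨_, mem_eval.2 ⟨?_, hn⟩⟩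
    clear hn
    induction n with
    | zero => exact Relation.ReflTransGen.refl
    | succ n ih =>
      rw [Function.iterate_succ_apply']
      generalize (fun b => (f b).getD b)^[n] a = b at ih ⊢
      cases h : f b with
      | none => exact ih
      | some d => exact ih.tail h

/-- An operation on one stack. -/
inductive StackOp (Γ : Type*)
  | keep
  | pop
  | push (a : Γ)

/-- The effect of an operation on the contents of a stack. -/
def StackOp.apply {Γ : Type*} : StackOp Γ → List Γ → List Γ
  | keep, l => l
  | pop, l => l.tail
  | push a, l => a :: l

/-- An instruction of a stack machine: perform `op` on `stack`, and pass to the control state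
given by `next` at the symbol that was on top of `stack` (`none` if the stack was empty). -/
structure Instruction (Q K Γ : Type*) where
  stack : K
  op : StackOp Γ
  next : Option Γ → Q

/-- A program with control states `Q` for stacks `K` over the alphabet `Γ`; it halts in the
control states without an instruction. -/
abbrev StackMachine (Q K Γ : Type*) := Q → Option (Instruction Q K Γ)

namespace StackMachine

variable {Q K Γ : Type*}

/-- The operation that is performed on the stack `k` in the control state `q`. -/
def opAt [DecidableEq K] (P : StackMachine Q K Γ) (q : Q) (k : K) : StackOp Γ :=
  match P q with
  | none => .keep
  | some i => if k = i.stack then i.op else .keep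

/-- One step of the computation. -/
def step [DecidableEq K] (P : StackMachine Q K Γ) (c : Q × (K → List Γ)) :
    Option (Q × (K → List Γ)) :=
  (P c.1).map fun i =>
    (i.next (c.2 i.stack).head?, Function.update c.2 i.stack (i.op.apply (c.2 i.stack)))

/-- The computation from the configuration `c` terminates. -/
def Halts [DecidableEq K] (P : StackMachine Q K Γ) (c : Q × (K → List Γ)) : Prop :=
  (eval P.step c).Dom

/-- The configuration after `n` steps; it stays constant once the computation has terminated. -/
def run [DecidableEq K] (P : StackMachine Q K Γ) (c : Q × (K → List Γ)) (n : ℕ) :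
    Q × (K → List Γ) :=
  (fun d => (P.step d).getD d)^[n] c

theorem halts_iff_exists_run [DecidableEq K] {P : StackMachine Q K Γ} {c : Q × (K → List Γ)} :
    P.Halts c ↔ ∃ n, P (P.run c n).1 = none := by
  simp only [Halts, eval_dom_iff_exists_iterate, step, run, Option.map_eq_none_iff]

theorem run_succ_fst [DecidableEq K] {P : StackMachine Q K Γ} {c : Q × (K → List Γ)} {n : ℕ}
    {i : Instruction Q K Γ} (hi : P (P.run c n).1 = some i) :
    (P.run c (n + 1)).1 = i.next ((P.run c n).2 i.stack).head? := by
  rw [run, Function.iterate_succ_apply', ← run, step, hi, Option.map_some, Option.getD_some]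

theorem run_succ_snd [DecidableEq K] (P : StackMachine Q K Γ) (c : Q × (K → List Γ)) (n : ℕ)
    (k : K) :
    (P.run c (n + 1)).2 k = (P.opAt (P.run c n).1 k).apply ((P.run c n).2 k) := by
  rw [run, Function.iterate_succ_apply', ← run, step, opAt]
  cases P (P.run c n).1 with
  | none => rfl
  | some i =>
    obtain rfl | hk := eq_or_ne k i.stack
    · simp
    · simp [hk, StackOp.apply]

/-- The restriction of a program to a set of control states that it does not leave. -/
def restrict (P : StackMachine Q K Γ) (X : Set Q)
    (hX : ∀ q ∈ X, ∀ i ∈ P q, ∀ o, i.next o ∈ X) : StackMachine X K Γ := fun q =>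
  (P q).pmap (fun i hi => ⟨i.stack, i.op, fun o => ⟨i.next o, hi o⟩⟩) (hX q q.2)

theorem halts_restrict [DecidableEq K] {P : StackMachine Q K Γ} {X : Set Q}
    (hX : ∀ q ∈ X, ∀ i ∈ P q, ∀ o, i.next o ∈ X) (q : X) (s : K → List Γ) :
    (P.restrict X hX).Halts (q, s) ↔ P.Halts (q, s) := by
  have hresp : Respects (P.restrict X hX).step P.step fun c d => d = ((c.1 : Q), c.2) := by
    rintro ⟨q, s⟩ _ rfl
    cases h : P q with
    | none => simp [step, restrict, h]
    | some i =>
      have hr : P.restrict X hX q =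
          some ⟨i.stack, i.op, fun o => ⟨i.next o, hX q q.2 i h o⟩⟩ := by
        simp [restrict, h]
      simp only [step, hr, Option.map_some]
      exact ⟨_, rfl, Relation.TransGen.single (by simp [step, h])⟩
  exact (tr_eval_dom hresp rfl).symm

open Turing TM2

variable {Λ σ : Type*}

/-- A multi-stack Turing machine as a stack machine. The control states are the statement that
remains to be executed, if any, together with the value of the internal variable. Statements that
use no stack keep the default one. -/
def ofTM2 [Inhabited K] (M : Λ → Stmt (fun _ : K => Γ) Λ σ) :
    StackMachine (Option (Stmt (fun _ : K => Γ) Λ σ) × σ) K Γ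
  | (none, _) => none
  | (some (.push k f q), v) => some ⟨k, .push (f v), fun _ => (some q, v)⟩
  | (some (.peek k f q), v) => some ⟨k, .keep, fun o => (some q, f v o)⟩
  | (some (.pop k f q), v) => some ⟨k, .pop, fun o => (some q, f v o)⟩
  | (some (.load a q), v) => some ⟨default, .keep, fun _ => (some q, a v)⟩
  | (some (.branch f q₁ q₂), v) => some ⟨default, .keep, fun _ => (some (cond (f v) q₁ q₂), v)⟩
  | (some (.goto l), v) => some ⟨default, .keep, fun _ => (some (M (l v)), v)⟩
  | (some .halt, v) => some ⟨default, .keep, fun _ => (none, v)⟩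

theorem ofTM2_reaches₁_stepAux [Inhabited K] [DecidableEq K]
    (M : Λ → Stmt (fun _ : K => Γ) Λ σ) (q : Stmt (fun _ : K => Γ) Λ σ) (v : σ)
    (s : K → List Γ) :
    Reaches₁ (ofTM2 M).step ((some q, v), s)
      (((stepAux q v s).l.map M, (stepAux q v s).var), (stepAux q v s).stk) := by
  induction q generalizing v s with
  | push k f q ih => exact Relation.TransGen.head rfl (ih _ _)
  | pop k f q ih => exact Relation.TransGen.head rfl (ih _ _)
  | peek k f q ih =>
    exact Relation.TransGen.head (by simp [step, ofTM2, StackOp.apply]) (ih _ _)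
  | load a q ih =>
    exact Relation.TransGen.head (by simp [step, ofTM2, StackOp.apply]) (ih _ _)
  | branch f q₁ q₂ ih₁ ih₂ =>
    have h : (ofTM2 M).step ((some (.branch f q₁ q₂), v), s) =
        some ((some (cond (f v) q₁ q₂), v), s) := by
      simp [step, ofTM2, StackOp.apply]
    rw [stepAux]
    refine Relation.TransGen.head h ?_
    cases f v
    exacts [ih₂ _ _, ih₁ _ _]
  | goto l => exact Relation.TransGen.single (by simp [step, ofTM2, StackOp.apply])
  | halt => exact Relation.TransGen.single (by simp [step, ofTM2, StackOp.apply])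

theorem halts_ofTM2 [Inhabited K] [DecidableEq K] (M : Λ → Stmt (fun _ : K => Γ) Λ σ)
    (c : Cfg (fun _ : K => Γ) Λ σ) :
    (ofTM2 M).Halts ((c.l.map M, c.var), c.stk) ↔ (eval (TM2.step M) c).Dom := by
  have hresp : Respects (TM2.step M) (ofTM2 M).step
      fun c d => d = ((c.l.map M, c.var), c.stk) := by
    rintro ⟨_ | l, v, s⟩ _ rfl
    · rfl
    · exact ⟨_, rfl, ofTM2_reaches₁_stepAux M (M l) v s⟩
  exact tr_eval_dom hresp rfl

theorem some_mem_stmts [Inhabited Λ] (M : Λ → Stmt (fun _ : K => Γ) Λ σ) {S : Finset Λ} {l : Λ}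
    (hl : l ∈ S) : some (M l) ∈ stmts M S := by
  simp only [stmts, Finset.some_mem_insertNone, Finset.mem_biUnion]
  exact ⟨l, hl, stmts₁_self⟩

theorem ofTM2_next_mem_stmts [Inhabited K] [Inhabited Λ] {M : Λ → Stmt (fun _ : K => Γ) Λ σ}
    {S : Finset Λ} (hS : Supports M S) {p : Option (Stmt (fun _ : K => Γ) Λ σ) × σ}
    (hp : p.1 ∈ stmts M S) {i} (hi : i ∈ ofTM2 M p) (o : Option Γ) :
    (i.next o).1 ∈ stmts M S := by
  obtain ⟨_ | q, v⟩ := p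
  · simp [ofTM2] at hi
  have hsub : ∀ q' ∈ stmts₁ q, some q' ∈ stmts M S := fun q' h => stmts_trans h hp
  cases q with
  | goto l =>
    cases hi
    exact some_mem_stmts M (stmts_supportsStmt hS hp v)
  | halt =>
    cases hi
    simp [stmts]
  | branch f q₁ q₂ =>
    cases hi
    apply hsub
    simp only [stmts₁, Finset.mem_insert, Finset.mem_union]
    cases f v
    exacts [.inr (.inr stmts₁_self), .inr (.inl stmts₁_self)]
  | push | peek | pop | load =>
    cases hi
    exact hsub _ (by simp [stmts₁, stmts₁_self])

end StackMachine

theorem exists_primrec_two_pow_sub_one_inverse :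
    ∃ g : ℕ → ℕ, Primrec g ∧ ∀ m, g (2 ^ m - 1) = m := by
  refine ⟨fun n => Nat.findGreatest (fun k => 2 ^ k ≤ n + 1) n,
    Primrec.nat_findGreatest Primrec.id <| Primrec.nat_le.comp
      ((Primrec₂.unpaired'.1 Nat.Primrec.pow).comp (Primrec.const 2) Primrec.snd)
      (Primrec.succ.comp Primrec.fst), fun m => ?_⟩
  have hlt := Nat.lt_two_pow_self (n := m)
  rw [Nat.findGreatest_eq_iff, Nat.sub_add_cancel (by lia)]
  exact ⟨by lia, fun _ => le_rfl, fun n hn _ => not_le.2 (Nat.pow_lt_pow_right (by simp) hn)⟩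

open Nat.Partrec in
theorem exists_code_eval_dom_iff : ∃ c : Turing.ToPartrec.Code, ∀ m : ℕ,
    (c.eval [2 ^ m - 1]).Dom ↔ ((Denumerable.ofNat Code m).eval 0).Dom := by
  obtain ⟨g, hg, hgm⟩ := exists_primrec_two_pow_sub_one_inverse
  have hf : Partrec fun n : ℕ => (Denumerable.ofNat Code (g n)).eval 0 :=
    Code.eval_part.comp ((Computable.ofNat _).comp hg.to_comp) (Computable.const 0)
  obtain ⟨c, hc⟩ := Turing.ToPartrec.Code.exists_code (Nat.Partrec'.part_iff₁.2 hf)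
  refine ⟨c, fun m => ?_⟩
  have hm : g (List.Vector.head ⟨[2 ^ m - 1], rfl⟩) = m := hgm m
  rw [hc ⟨[2 ^ m - 1], rfl⟩, hm]
  rfl

namespace StackMachine

open Turing PartrecToTM2

theorem trNat_two_pow_sub_one (m : ℕ) : trNat (2 ^ m - 1) = List.replicate m Γ'.bit1 := by
  induction m with
  | zero => simp
  | succ m ih =>
    have hpow : 2 ^ (m + 1) - 1 = (2 ^ m - 1) + (2 ^ m - 1) + 1 := by
      have := Nat.one_le_two_pow (n := m)
      lia
    have hbit (n : Num) : trNum n.bit1 = Γ'.bit1 :: trNum n := by cases n <;> rfl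
    rw [hpow, trNat, Nat.cast_add, Nat.cast_add, Nat.cast_one, Num.bit1_of_bit1, hbit,
      List.replicate_succ, ← ih, trNat]

instance : Finite K' :=
  Finite.of_injective (fun | .main => 0 | .rev => 1 | .aux => 2 | .stack => 3 : K' → Fin 4)
    fun k l => by cases k <;> cases l <;> simp

/-- The control states of the stack machine that evaluates `c`: the statements occurring in the
TM2 program for `c`, paired with the values of its internal variable. -/
abbrev codeStates (c : ToPartrec.Code) :
    Set (Option (TM2.Stmt (fun _ : K' => Γ') Λ' (Option Γ')) × Option Γ') :=
  {p | p.1 ∈ TM2.stmts tr (codeSupp c Cont'.halt)}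

instance (c : ToPartrec.Code) : Finite (codeStates c) :=
  (((Finset.finite_toSet _).prod Set.finite_univ).subset fun _ hp => ⟨hp, trivial⟩).to_subtype

theorem exists_halts_iff_code_eval_dom (c : ToPartrec.Code) :
    ∃ (P : StackMachine (codeStates c) K' Γ') (q₀ : codeStates c), ∀ v : List ℕ,
      P.Halts (q₀, K'.elim (trList v) [] [] []) ↔ (c.eval v).Dom := by
  let : Inhabited Λ' := ⟨trNormal c Cont'.halt⟩
  have hS := tr_supports c Cont'.halt
  refine ⟨(ofTM2 tr).restrict (codeStates c) fun _ hq _ => ofTM2_next_mem_stmts hS hq,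
    ⟨(some (tr (trNormal c Cont'.halt)), none), some_mem_stmts tr hS.1⟩, fun v => ?_⟩
  have h := halts_ofTM2 tr (init c v)
  rw [PartrecToTM2.tr_eval] at h
  rw [halts_restrict]
  exact h

theorem exists_halts_iff_halting_problem :
    ∃ (Q K Γ : Type) (_ : Finite Q) (_ : Finite K) (_ : Finite Γ) (_ : DecidableEq K)
      (P : StackMachine Q K Γ) (q₀ : Q) (k₀ : K) (a e : Γ), ∀ m : ℕ,
      P.Halts (q₀, Function.update (fun _ => []) k₀ (List.replicate m a ++ [e])) ↔
        ((Denumerable.ofNat Nat.Partrec.Code m).eval 0).Dom := by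
  obtain ⟨c, hc⟩ := exists_code_eval_dom_iff
  obtain ⟨P, q₀, hP⟩ := exists_halts_iff_code_eval_dom c
  refine ⟨codeStates c, K', Γ', inferInstance, inferInstance, inferInstance, inferInstance, P, q₀,
    K'.main, Γ'.bit1, Γ'.cons, fun m => ?_⟩
  have hstacks : Function.update (fun _ => []) K'.main (List.replicate m Γ'.bit1 ++ [Γ'.cons]) =
      K'.elim (trList [2 ^ m - 1]) [] [] [] := by
    funext k
    cases k <;> simp [trList, trNat_two_pow_sub_one]
  rw [hstacks, hP, hc]

end StackMachine

end StackMachines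

open FirstOrder Formula

/-- Binary predicates standing for partial functions: the cell on top of the stack `k` of a
configuration, the cell below the top one, the cell below a cell, the next configuration and the
previous one. -/
inductive FunSym (K : Type*)
  | top (k : K)
  | below (k : K)
  | next
  | step
  | prev
  deriving Fintype

instance {K : Type*} [Finite K] : Finite (FunSym K) :=
  have := Fintype.ofFinite K
  inferInstance

/-- A numbering of a finite type, which provides the names of relation symbols. -/
noncomputable def index {α : Type*} [Finite α] (a : α) : ℕ := Finite.equivFin α a

theorem index_injective {α : Type*} [Finite α] : Function.Injective (index : α → ℕ) :=
  Fin.val_injective.comp (Finite.equivFin α).injective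

section Formulas

variable {Q K Γ : Type*} [Finite Q] [Finite K] [Finite Γ]

/-- A closed valid formula. -/
def verum : Formula := allBlock [0] ((eq 0 0).imp (eq 0 0))

/-- The conjunction of a finite family of formulae. -/
noncomputable def conj {ι : Type*} [Finite ι] (F : ι → Formula) : Formula :=
  (List.ofFn (F ∘ (Finite.equivFin ι).symm)).foldr Formula.and verum

/-- The atom saying that the configuration `x` is in the control state `q`. The unary relation
symbols with even numbers are used for control states, those with odd numbers for `symAtom`. -/
noncomputable def stateAtom (q : Q) (x : ℕ) : Formula := rel (2 * index q) ![x]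

/-- The atom saying that the stack cell `x` contains `o`, where `none` marks the bottom. -/
noncomputable def symAtom (o : Option Γ) (x : ℕ) : Formula := rel (2 * index o + 1) ![x]

/-- The atom of the binary relation symbol that encodes `f`. -/
noncomputable def edge (f : FunSym K) (x y : ℕ) : Formula := rel (index f) ![x, y]

/-- The atom of a ternary relation symbol that serves only as a guard for all three variables. -/
def guardAtom : Formula := rel 0 ![0, 1, 2]

/-- The formula saying that the partial function `f` maps `x` to `y`. -/
noncomputable def app (f : FunSym K) (x y : ℕ) : Formula := (edge f x y).and (eq x y).neg

/-- The sentence forcing `f` to be a partial function: half of the `f`-successors of every `x` are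
equal to `x`, so that there are none, or `x` itself and exactly one more. -/
noncomputable def functional (f : FunSym K) : Formula :=
  allBlock [0] ((eq 0 0).imp (perc 50 (index f) 0 1 (eq 0 1)))

/-- The sentence saying that `φ` holds whenever `f` maps the variable `0` to the variable `1`. -/
noncomputable def rule (f : FunSym K) (φ : Formula) : Formula :=
  allBlock [0, 1] ((edge f 0 1).imp ((eq 0 1).neg.imp φ))

/-- The formula saying that `f` maps `x` to some `y` with `φ`. -/
noncomputable def wit (f : FunSym K) (x y : ℕ) (φ : Formula) : Formula :=
  exBlock [y] ((edge f x y).and ((eq x y).neg.and φ))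

/-- The formula saying that `f` maps the variable `0` and `g` maps the variable `1` to the same
element. -/
noncomputable def meet (f g : FunSym K) : Formula :=
  exBlock [2] (guardAtom.and ((app f 0 2).and (app g 1 2)))

/-- The formula saying that the stack `k` of the configuration in the variable `1` arises by `op`
from that of the configuration in the variable `0`. -/
noncomputable def opFormula (k : K) : StackOp Γ → Formula
  | .keep => meet (.top k) (.top k)
  | .pop => meet (.below k) (.top k)
  | .push a => (meet (.top k) (.below k)).and (wit (.top k) 1 2 (symAtom (some a) 2))

section

variable (K)

/-- The formula saying that the cell in the variable `1` contains `a`, and that the cell below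
satisfies `φ`. The equality guards `φ`, so that the variable `1` can be requantified. -/
noncomputable def contentCons (a : Γ) (φ : Formula) : Formula :=
  (symAtom (some a) 1).and (wit (.next : FunSym K) 1 0 (exBlock [1] ((eq 1 0).and φ)))

/-- The formula saying that the cells from the variable `1` downwards contain the given word. -/
noncomputable def content : List Γ → Formula
  | [] => symAtom (none : Option Γ) 1
  | a :: l => contentCons K a (content l)

end

variable (K Γ) in
/-- The sentence relating the functions that describe stacks and runs. -/
noncomputable def dataSentence : Formula :=
  (conj fun f : FunSym K => functional f).and <|
  (conj fun k : K => rule (.top k) (meet (.below k) .next)).and <|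
  (rule (.next : FunSym K)
    ((symAtom (none : Option Γ) 0).imp (symAtom (none : Option Γ) 1))).and <|
  rule (.step : FunSym K) (app (.prev : FunSym K) 1 0)

/-- The sentence saying that configurations in the control state `q` have a successor whose control
state is given by the instruction `i`. -/
noncomputable def instructionSentence (q : Q) (i : Instruction Q K Γ) : Formula :=
  (allBlock [0] ((stateAtom q 0).imp (wit (.step : FunSym K) 0 1 verum))).and <|
  conj fun o : Option Γ => rule (.step : FunSym K)
    (((stateAtom q 0).and (wit (.top i.stack) 0 2 (symAtom o 2))).imp (stateAtom (i.next o) 1))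

/-- The sentence describing the transitions from the control state `q`. -/
noncomputable def transitionSentence [DecidableEq K] (P : StackMachine Q K Γ) (q : Q) : Formula :=
  ((P q).elim verum (instructionSentence q)).and <|
  conj fun k : K => rule (.step : FunSym K) ((stateAtom q 0).imp (opFormula k (P.opAt q k)))

/-- The sentence saying that some element without predecessor represents the configuration `c`. -/
noncomputable def initSentence (c : Q × (K → List Γ)) : Formula :=
  exBlock [0] ((stateAtom c.1 0).and ((wit (.prev : FunSym K) 0 1 verum).neg.and
    (conj fun k : K => wit (.top k) 0 1 (content K (c.2 k)))))

/-- The sentence that has a finite model if and only if `P` halts from the configuration `c`. -/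
noncomputable def haltSentence [DecidableEq K] (P : StackMachine Q K Γ) (c : Q × (K → List Γ)) :
    Formula :=
  ((dataSentence K Γ).and (conj (transitionSentence P))).and (initSentence c)

end Formulas

section Fragment

variable {Q K Γ : Type*} [Finite Q] [Finite K] [Finite Γ] {X Y : Finset ℕ} {φ ψ γ : Formula}

theorem free_allBlock (ys : List ℕ) (φ : Formula) :
    (allBlock ys φ).free = φ.free \ ys.toFinset := by
  induction ys with
  | nil => simp [allBlock]
  | cons y ys ih =>
    rw [allBlock, List.foldr_cons, ← allBlock, free, ih]
    grind [List.toFinset_cons]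

theorem vars_allBlock (ys : List ℕ) (φ : Formula) :
    (allBlock ys φ).vars = φ.vars ∪ ys.toFinset := by
  induction ys with
  | nil => simp [allBlock]
  | cons y ys ih =>
    rw [allBlock, List.foldr_cons, ← allBlock, vars, ih]
    grind [List.toFinset_cons]

theorem arityLE_allBlock {m : ℕ} (ys : List ℕ) (φ : Formula) :
    (allBlock ys φ).ArityLE m ↔ φ.ArityLE m := by
  induction ys with
  | nil => rfl
  | cons _ _ ih => exact ih

/-- Membership in the three-variable fragment over symbols of arity at most three, for formulae
with free variables in `X`. -/
structure IsTernaryOn (X : Finset ℕ) (φ : Formula) : Prop where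
  gfLoc : φ.GFLoc
  free_subset : φ.free ⊆ X
  vars_lt : ∀ x ∈ φ.vars, x < 3
  arityLE : φ.ArityLE 3

namespace IsTernaryOn

theorem mono (h : IsTernaryOn X φ) (hXY : X ⊆ Y) : IsTernaryOn Y φ :=
  ⟨h.gfLoc, h.free_subset.trans hXY, h.vars_lt, h.arityLE⟩

theorem rel {n : ℕ} {r : ℕ} {v : Fin n → ℕ} (hn : n ≤ 3 := by simp)
    (hv : ∀ i, v i < 3 := by simp [Fin.forall_fin_succ])
    (hX : ∀ i, v i ∈ X := by simp [Fin.forall_fin_succ]) : IsTernaryOn X (rel r v) where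
  gfLoc := .atom trivial
  free_subset := by simpa [free, Finset.image_subset_iff] using hX
  vars_lt := by simpa [vars] using hv
  arityLE := hn

theorem eq {x y : ℕ} (hx : x < 3 := by simp) (hy : y < 3 := by simp) (hxX : x ∈ X := by simp)
    (hyX : y ∈ X := by simp) : IsTernaryOn X (eq x y) where
  gfLoc := .atom trivial
  free_subset := by simp [free, Finset.insert_subset_iff, hxX, hyX]
  vars_lt := by simp [vars, hx, hy]
  arityLE := trivial

theorem neg (h : IsTernaryOn X φ) : IsTernaryOn X φ.neg :=
  ⟨.neg h.gfLoc, h.free_subset, h.vars_lt, h.arityLE⟩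

theorem and (hφ : IsTernaryOn X φ) (hψ : IsTernaryOn X ψ) : IsTernaryOn X (φ.and ψ) where
  gfLoc := .and hφ.gfLoc hψ.gfLoc
  free_subset := Finset.union_subset hφ.free_subset hψ.free_subset
  vars_lt x hx := (Finset.mem_union.1 hx).elim (hφ.vars_lt x) (hψ.vars_lt x)
  arityLE := ⟨hφ.arityLE, hψ.arityLE⟩

theorem imp (hφ : IsTernaryOn X φ) (hψ : IsTernaryOn X ψ) : IsTernaryOn X (φ.imp ψ) where
  gfLoc := .imp hφ.gfLoc hψ.gfLoc
  free_subset := Finset.union_subset hφ.free_subset hψ.free_subset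
  vars_lt x hx := (Finset.mem_union.1 hx).elim (hφ.vars_lt x) (hψ.vars_lt x)
  arityLE := ⟨hφ.arityLE, hψ.arityLE⟩

theorem exBlock {y : ℕ} (hatom : γ.IsAtom) (hγ : IsTernaryOn (insert y X) γ)
    (hψ : IsTernaryOn Y ψ) (hY : Y ⊆ γ.free) (hy : y < 3 := by simp) :
    IsTernaryOn X (exBlock [y] (γ.and ψ)) where
  gfLoc := .ex _ hatom (hψ.free_subset.trans hY) hψ.gfLoc
  free_subset := by
    have := hψ.free_subset
    have := hγ.free_subset
    simp only [Formula.exBlock, List.foldr, free]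
    grind
  vars_lt := by
    have := hψ.vars_lt
    have := hγ.vars_lt
    simp only [Formula.exBlock, List.foldr, vars]
    grind
  arityLE := ⟨hγ.arityLE, hψ.arityLE⟩

theorem allBlock {ys : List ℕ} (hatom : γ.IsAtom) (hγ : IsTernaryOn (ys.toFinset ∪ X) γ)
    (hψ : IsTernaryOn Y ψ) (hY : Y ⊆ γ.free) (hys : ∀ y ∈ ys, y < 3 := by simp) :
    IsTernaryOn X (allBlock ys (γ.imp ψ)) where
  gfLoc := .all _ hatom (hψ.free_subset.trans hY) hψ.gfLoc
  free_subset := by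
    have := hψ.free_subset
    have := hγ.free_subset
    rw [free_allBlock, free]
    grind
  vars_lt := by
    have := hψ.vars_lt
    have := hγ.vars_lt
    rw [vars_allBlock, vars]
    grind [List.mem_toFinset]
  arityLE := (arityLE_allBlock _ _).2 ⟨hγ.arityLE, hψ.arityLE⟩

theorem verum : IsTernaryOn X verum :=
  .allBlock trivial (.eq (X := [0].toFinset ∪ X)) (.eq (X := {0})) (by simp [free])

theorem conj {ι : Type*} [Finite ι] {F : ι → Formula} (h : ∀ i, IsTernaryOn X (F i)) :
    IsTernaryOn X (conj F) := by
  have hfoldr (l : List Formula) (hl : ∀ φ ∈ l, IsTernaryOn X φ) :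
      IsTernaryOn X (l.foldr Formula.and PercLogic.verum) := by
    induction l with
    | nil => exact verum
    | cons φ l ih =>
      rw [List.forall_mem_cons] at hl
      exact hl.1.and (ih hl.2)
  exact hfoldr _ ((List.forall_mem_ofFn_iff).2 fun _ => h _)

theorem app {f : FunSym K} {x y : ℕ} (hx : x < 3 := by simp) (hy : y < 3 := by simp)
    (hxX : x ∈ X := by simp) (hyX : y ∈ X := by simp) : IsTernaryOn X (app f x y) :=
  .and (.rel (by simp) (by simp [Fin.forall_fin_two, hx, hy])
    (by simp [Fin.forall_fin_two, hxX, hyX])) (.neg (.eq hx hy hxX hyX))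

theorem functional (f : FunSym K) : IsTernaryOn ∅ (functional f) :=
  .allBlock trivial .eq (Y := {0})
    ⟨.perc _ (by simp) (by norm_num) (by simp) (by simp [free]) (.atom trivial),
      by simp only [free]; decide, by simp [vars], by simp [ArityLE]⟩ (by simp [free])

theorem rule {f : FunSym K} (h : IsTernaryOn {0, 1} φ) : IsTernaryOn ∅ (rule f φ) :=
  .allBlock trivial .rel (.imp (.neg .eq) h) (by simp [edge, free, Finset.subset_iff])

theorem wit {f : FunSym K} {x y : ℕ} (h : IsTernaryOn {x, y} φ) (hx : x < 3 := by simp)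
    (hy : y < 3 := by simp) (hX : x ∈ X := by simp) : IsTernaryOn X (wit f x y φ) :=
  .exBlock trivial (.rel (by simp) (by simp [Fin.forall_fin_two, hx, hy])
    (by simp [Fin.forall_fin_two, hX])) (.and (.neg (.eq hx hy)) h)
    (by simp [edge, free, Finset.subset_iff]) hy

theorem meet {f g : FunSym K} : IsTernaryOn {0, 1} (meet f g) :=
  .exBlock trivial .rel (Y := {0, 1, 2}) (.and .app .app)
    (by simp [guardAtom, free, Finset.subset_iff, Fin.exists_fin_succ])

theorem opFormula (k : K) (op : StackOp Γ) : IsTernaryOn {0, 1} (opFormula k op) :=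
  match op with
  | .keep | .pop => .meet
  | .push _ => .and .meet (.wit .rel)

theorem content (l : List Γ) : IsTernaryOn {1} (content K l) := by
  induction l with
  | nil => exact .rel
  | cons a l ih => exact .and .rel (.wit (.exBlock trivial .eq ih (by simp [free])))

theorem dataSentence : IsTernaryOn ∅ (dataSentence K Γ) :=
  .and (.conj .functional) <| .and (.conj fun _ => .rule .meet) <|
    .and (.rule (.imp .rel .rel)) (.rule .app)

theorem instructionSentence (q : Q) (i : Instruction Q K Γ) :
    IsTernaryOn ∅ (instructionSentence q i) :=
  .and (.allBlock trivial .rel (.wit (X := {0}) .verum) (by simp [stateAtom, free]))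
    (.conj fun _ => .rule (.imp (.and .rel (.wit .rel)) .rel))

theorem transitionSentence [DecidableEq K] (P : StackMachine Q K Γ) (q : Q) :
    IsTernaryOn ∅ (transitionSentence P q) := by
  refine .and ?_ (.conj fun k => .rule (.imp .rel (.opFormula k _)))
  cases P q with
  | none => exact .verum
  | some i => exact .instructionSentence q i

theorem initSentence (c : Q × (K → List Γ)) : IsTernaryOn ∅ (initSentence c) :=
  .exBlock trivial .rel (Y := {0}) (.and (.neg (.wit .verum)) (.conj fun _ =>
    .wit ((IsTernaryOn.content _).mono (by simp)))) (by simp [stateAtom, free])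

theorem haltSentence [DecidableEq K] (P : StackMachine Q K Γ) (c : Q × (K → List Γ)) :
    IsTernaryOn ∅ (haltSentence P c) :=
  .and (.and .dataSentence (.conj (.transitionSentence P))) (.initSentence c)

end IsTernaryOn

end Fragment

/-- An interpretation of the vocabulary of `haltSentence` in `M`: the control states of
configurations, the symbols in stack cells, the graphs of the partial functions, and the guard. -/
@[ext]
structure Interpretation (Q K Γ M : Type*) where
  state : Q → M → Prop
  sym : Option Γ → M → Prop
  map : FunSym K → M → M → Prop
  guard : M → M → M → Prop

namespace Interpretation

variable {Q K Γ M : Type*}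

/-- Both `f` at `x` and `g` at `y` have the same value, witnessed by a guarded triple. -/
def Meet (A : Interpretation Q K Γ M) (f g : FunSym K) (x y : M) : Prop :=
  ∃ z, A.guard x y z ∧ A.map f x z ∧ A.map g y z

/-- The stack `k` of the configuration `y` arises by the given operation from that of `x`. -/
def OpRel (A : Interpretation Q K Γ M) (k : K) (x y : M) : StackOp Γ → Prop
  | .keep => A.Meet (.top k) (.top k) x y
  | .pop => A.Meet (.below k) (.top k) x y
  | .push a => A.Meet (.top k) (.below k) x y ∧ ∃ z, A.map (.top k) y z ∧ A.sym (some a) z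

/-- The cells from the given one downwards contain the given word. -/
def Represents (A : Interpretation Q K Γ M) : List Γ → M → Prop
  | [], x => A.sym none x
  | a :: l, x => A.sym (some a) x ∧ ∃ y, A.map .next x y ∧ A.Represents l y

/-- The element `x` represents the configuration `c`. -/
def RepresentsCfg (A : Interpretation Q K Γ M) (c : Q × (K → List Γ)) (x : M) : Prop :=
  A.state c.1 x ∧ ∀ k, ∃ y, A.map (.top k) x y ∧ A.Represents (c.2 k) y

/-- The interpretation contains an encoding of the run of `P` from the configuration `c`. -/
structure IsTrace [DecidableEq K] (P : StackMachine Q K Γ) (c : Q × (K → List Γ))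
    (A : Interpretation Q K Γ M) : Prop where
  rightUnique : ∀ f, Relator.RightUnique (A.map f)
  below : ∀ k x y, A.map (.top k) x y → A.Meet (.below k) .next x y
  bottom : ∀ x y, A.map .next x y → A.sym none x → A.sym none y
  prev_of_step : ∀ x y, A.map .step x y → A.map .prev y x
  progress : ∀ q i, P q = some i → ∀ x, A.state q x → ∃ y, A.map .step x y
  control : ∀ q i, P q = some i → ∀ o x y, A.map .step x y → A.state q x →
    ∀ z, A.map (.top i.stack) x z → A.sym o z → A.state (i.next o) y
  stack : ∀ q k x y, A.map .step x y → A.state q x → A.OpRel k x y (P.opAt q k)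
  exists_init : ∃ x, A.RepresentsCfg c x ∧ ∀ y, ¬ A.map .prev x y

end Interpretation

/-- The relation `r` encodes a partial function: `x` has no `r`-successors if the function is
undefined at `x`, and otherwise its `r`-successors are `x` itself and the value at `x`. -/
def EncodesPartialFun {α : Type*} (r : α → α → Prop) : Prop :=
  ∀ x, {y | r x y} = ∅ ∨ r x x ∧ ∃! y, r x y ∧ x ≠ y

theorem EncodesPartialFun.rightUnique {α : Type*} {r : α → α → Prop} (h : EncodesPartialFun r) :
    Relator.RightUnique fun x y => r x y ∧ x ≠ y := by
  intro x y z hy hz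
  obtain hempty | ⟨-, hunique⟩ := h x
  · exact absurd hy.1 (Set.eq_empty_iff_forall_notMem.1 hempty y)
  · exact hunique.unique hy hz

theorem encodesPartialFun_or_eq {α : Type*} {r : α → α → Prop} (hr : Relator.RightUnique r)
    (hirrefl : ∀ x, ¬ r x x) : EncodesPartialFun fun x y => r x y ∨ x = y ∧ ∃ z, r x z := by
  intro x
  by_cases hx : ∃ z, r x z
  · obtain ⟨z, hz⟩ := hx
    have hxz : x ≠ z := fun h => hirrefl x (h ▸ hz)
    exact .inr ⟨.inr ⟨rfl, z, hz⟩, z, ⟨.inl hz, hxz⟩,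
      fun y hy => hr (hy.1.resolve_right fun h => hy.2 h.1) hz⟩
  · exact .inl (Set.eq_empty_iff_forall_notMem.2 fun y hy =>
      hx (hy.elim (fun h => ⟨y, h⟩) And.right))

theorem ncard_setOf_and_eq_half_iff {α : Type*} {S : Set α} (hS : S.Finite) (a : α) :
    ({b | b ∈ S ∧ a = b}.ncard : ℚ) = 50 / 100 * S.ncard ↔
      S = ∅ ∨ a ∈ S ∧ ∃! b, b ∈ S ∧ a ≠ b := by
  by_cases ha : a ∈ S
  · have hself : {b | b ∈ S ∧ a = b} = {a} := by grind
    have hcard : (S \ {a}).ncard + 1 = S.ncard := Set.ncard_sdiff_singleton_add_one ha hS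
    have hunique : (∃! b, b ∈ S ∧ a ≠ b) ↔ (S \ {a}).ncard = 1 := by
      simp only [Set.ncard_eq_one, Set.eq_singleton_iff_unique_mem, ExistsUnique, Set.mem_sdiff,
        Set.mem_singleton_iff, ne_comm (a := a), ne_eq]
    have hne : S ≠ ∅ := Set.nonempty_iff_ne_empty.1 ⟨a, ha⟩
    rw [hself, Set.ncard_singleton, ← hcard, hunique]
    simp only [hne, ha, false_or, true_and]
    push_cast
    constructor
    · intro h
      exact_mod_cast (by linarith : ((S \ {a}).ncard : ℚ) = 1)
    · intro h
      rw [h]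
      norm_num
  · have hself : {b | b ∈ S ∧ a = b} = ∅ := by grind
    have hempty : (0 : ℚ) = 50 / 100 * S.ncard ↔ S = ∅ := by
      rw [← Set.ncard_eq_zero hS, ← Nat.cast_eq_zero (R := ℚ)]
      constructor <;> intro h <;> linarith
    simpa [hself, ha] using hempty

section Semantics

variable {Q K Γ : Type*} [Finite Q] [Finite K] [Finite Γ] {M : Type} [relLang.Structure M]

/-- The relation that interprets the binary symbol encoding `f`. -/
def edgeRel (M : Type) [relLang.Structure M] (f : FunSym K) (x y : M) : Prop :=
  Language.Structure.RelMap (L := relLang) (n := 2) (index f) ![x, y]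

variable (Q K Γ M) in
/-- The interpretation read off from a structure. An edge from `x` to `y ≠ x` encodes that `f`
maps `x` to `y`; loops carry no information. -/
def interp : Interpretation Q K Γ M where
  state q x := Language.Structure.RelMap (L := relLang) (n := 1) (2 * index q) ![x]
  sym o x := Language.Structure.RelMap (L := relLang) (n := 1) (2 * index o + 1) ![x]
  map f x y := edgeRel M f x y ∧ x ≠ y
  guard x y z := Language.Structure.RelMap (L := relLang) (n := 3) (0 : ℕ) ![x, y, z]

theorem sat_rel {n : ℕ} (r : ℕ) (v : Fin n → ℕ) (s : ℕ → M) :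
    (rel r v).Sat s ↔ Language.Structure.RelMap (L := relLang) (n := n) r (s ∘ v) :=
  Iff.rfl

variable (K Γ) in
theorem sat_stateAtom (q : Q) (x : ℕ) (s : ℕ → M) :
    (stateAtom q x).Sat s ↔ (interp Q K Γ M).state q (s x) := by
  rw [stateAtom, sat_rel, ← FinVec.map_eq]
  rfl

variable (Q K) in
theorem sat_symAtom (o : Option Γ) (x : ℕ) (s : ℕ → M) :
    (symAtom o x).Sat s ↔ (interp Q K Γ M).sym o (s x) := by
  rw [symAtom, sat_rel, ← FinVec.map_eq]
  rfl

theorem sat_edge (f : FunSym K) (x y : ℕ) (s : ℕ → M) :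
    (edge f x y).Sat s ↔ edgeRel M f (s x) (s y) := by
  rw [edge, sat_rel, ← FinVec.map_eq]
  rfl

variable (Q K Γ) in
theorem sat_guardAtom (s : ℕ → M) :
    guardAtom.Sat s ↔ (interp Q K Γ M).guard (s 0) (s 1) (s 2) := by
  rw [guardAtom, sat_rel, ← FinVec.map_eq]
  rfl

theorem sat_verum (s : ℕ → M) : verum.Sat s := by
  simp [verum, allBlock, Sat]

theorem sat_conj {ι : Type*} [Finite ι] (F : ι → Formula) (s : ℕ → M) :
    (conj F).Sat s ↔ ∀ i, (F i).Sat s := by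
  have hfoldr (l : List Formula) : (l.foldr Formula.and verum).Sat s ↔ ∀ φ ∈ l, φ.Sat s := by
    induction l with
    | nil => simp [sat_verum]
    | cons φ l ih => simp [Sat, ih]
  rw [conj, hfoldr, List.forall_mem_ofFn_iff]
  exact (Finite.equivFin ι).symm.forall_congr_right (q := fun i => (F i).Sat s)

theorem sat_functional [Finite M] (f : FunSym K) (s : ℕ → M) : (functional f).Sat s ↔
    EncodesPartialFun (edgeRel M f) := by
  simp only [functional, allBlock, List.foldr, Sat, forall_true_left, Function.update_self, ne_eq,
    zero_ne_one, not_false_eq_true, Function.update_of_ne]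
  exact forall_congr' fun x => ncard_setOf_and_eq_half_iff (Set.toFinite {y | edgeRel M f x y}) x

section

variable (Q Γ)

theorem sat_app (f : FunSym K) (x y : ℕ) (s : ℕ → M) :
    (app f x y).Sat s ↔ (interp Q K Γ M).map f (s x) (s y) := by
  simp [app, Sat, sat_edge, interp]

theorem sat_rule (f : FunSym K) (φ : Formula) (s : ℕ → M) :
    (rule f φ).Sat s ↔ ∀ x y, (interp Q K Γ M).map f x y →
      φ.Sat (Function.update (Function.update s 0 x) 1 y) := by
  simp [rule, allBlock, Sat, sat_edge, interp]

theorem sat_wit (f : FunSym K) {x y : ℕ} (hxy : x ≠ y) (φ : Formula) (s : ℕ → M) :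
    (wit f x y φ).Sat s ↔
      ∃ z, (interp Q K Γ M).map f (s x) z ∧ φ.Sat (Function.update s y z) := by
  simp [wit, exBlock, Sat, sat_edge, interp, hxy, and_assoc]

theorem sat_meet (f g : FunSym K) (s : ℕ → M) :
    (meet f g).Sat s ↔ (interp Q K Γ M).Meet f g (s 0) (s 1) := by
  simp [meet, exBlock, Sat, sat_guardAtom Q K Γ, sat_app Q Γ, Interpretation.Meet]

end

variable (Q) in
theorem sat_opFormula (k : K) (op : StackOp Γ) (s : ℕ → M) :
    (opFormula k op).Sat s ↔ (interp Q K Γ M).OpRel k (s 0) (s 1) op := by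
  cases op <;>
    simp [opFormula, Interpretation.OpRel, Sat, sat_meet Q Γ, sat_wit Q Γ, sat_symAtom Q K]

variable (Q) in
theorem sat_content (l : List Γ) (s : ℕ → M) :
    (content K l).Sat s ↔ (interp Q K Γ M).Represents l (s 1) := by
  induction l generalizing s with
  | nil => exact sat_symAtom Q K none 1 s
  | cons a l ih =>
    simp [content, contentCons, Interpretation.Represents, Sat, sat_symAtom Q K, sat_wit Q Γ,
      exBlock, ih]

variable (Q) in
theorem sat_dataSentence [Finite M] (s : ℕ → M) : (dataSentence K Γ).Sat s ↔
    (∀ f : FunSym K, EncodesPartialFun (edgeRel M f)) ∧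
    (∀ k x y, (interp Q K Γ M).map (.top k) x y → (interp Q K Γ M).Meet (.below k) .next x y) ∧
    (∀ x y, (interp Q K Γ M).map .next x y →
      (interp Q K Γ M).sym none x → (interp Q K Γ M).sym none y) ∧
    ∀ x y, (interp Q K Γ M).map .step x y → (interp Q K Γ M).map .prev y x := by
  simp [dataSentence, Sat, sat_conj, sat_functional, sat_rule Q Γ, sat_meet Q Γ, sat_symAtom Q K,
    sat_app Q Γ]

theorem sat_instructionSentence (q : Q) (i : Instruction Q K Γ) (s : ℕ → M) :
    (instructionSentence q i).Sat s ↔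
      (∀ x, (interp Q K Γ M).state q x → ∃ y, (interp Q K Γ M).map .step x y) ∧
      ∀ o x y, (interp Q K Γ M).map .step x y → (interp Q K Γ M).state q x →
        ∀ z, (interp Q K Γ M).map (.top i.stack) x z → (interp Q K Γ M).sym o z →
          (interp Q K Γ M).state (i.next o) y := by
  simp [instructionSentence, Sat, allBlock, sat_conj, sat_rule Q Γ, sat_stateAtom K Γ,
    sat_symAtom Q K, sat_wit Q Γ, sat_verum]

theorem sat_transitionSentence [DecidableEq K] (P : StackMachine Q K Γ) (q : Q) (s : ℕ → M) :
    (transitionSentence P q).Sat s ↔ (∀ i, P q = some i → (instructionSentence q i).Sat s) ∧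
      ∀ k x y, (interp Q K Γ M).map .step x y → (interp Q K Γ M).state q x →
        (interp Q K Γ M).OpRel k x y (P.opAt q k) := by
  cases h : P q <;>
    simp [transitionSentence, Sat, h, sat_verum, sat_conj, sat_rule Q Γ, sat_stateAtom K Γ,
      sat_opFormula Q]

theorem sat_initSentence (c : Q × (K → List Γ)) (s : ℕ → M) : (initSentence c).Sat s ↔
    ∃ x, (interp Q K Γ M).RepresentsCfg c x ∧ ∀ y, ¬ (interp Q K Γ M).map .prev x y := by
  simp [initSentence, Interpretation.RepresentsCfg, Sat, exBlock, sat_conj, sat_stateAtom K Γ,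
    sat_wit Q Γ, sat_verum, sat_content Q, and_assoc, and_comm (a := ∀ _, ¬ _)]

theorem sat_haltSentence [DecidableEq K] [Finite M] (P : StackMachine Q K Γ)
    (c : Q × (K → List Γ)) (s : ℕ → M) : (haltSentence P c).Sat s ↔
      (∀ f : FunSym K, EncodesPartialFun (edgeRel M f)) ∧ (interp Q K Γ M).IsTrace P c := by
  simp only [haltSentence, Sat, sat_dataSentence Q, sat_conj, sat_transitionSentence,
    sat_instructionSentence, sat_initSentence]
  constructor
  · rintro ⟨⟨⟨hfun, hbelow, hbottom, hprev⟩, htrans⟩, hinit⟩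
    exact ⟨hfun, fun f => (hfun f).rightUnique, hbelow, hbottom, hprev,
      fun q i hi => ((htrans q).1 i hi).1, fun q i hi => ((htrans q).1 i hi).2,
      fun q => (htrans q).2, hinit⟩
  · rintro ⟨hfun, hA⟩
    exact ⟨⟨⟨hfun, hA.below, hA.bottom, hA.prev_of_step⟩, fun q =>
      ⟨fun i hi => ⟨hA.progress q i hi, hA.control q i hi⟩, hA.stack q⟩⟩, hA.exists_init⟩

end Semantics

theorem injective_of_rightUnique {α : Type*} {r : α → α → Prop} (hr : Relator.RightUnique r)
    {x : ℕ → α} (h0 : ∀ y, ¬ r (x 0) y) (hs : ∀ n, r (x (n + 1)) (x n)) :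
    Function.Injective x := by
  intro m
  induction m with
  | zero =>
    rintro (_ | n) h
    · rfl
    · exact absurd (h ▸ hs n) (h0 _)
  | succ m ih =>
    rintro (_ | n) h
    · exact absurd (h ▸ hs m) (h0 _)
    · rw [ih (hr (hs m) (h ▸ hs n))]

namespace Interpretation

variable {Q K Γ M : Type*} {A : Interpretation Q K Γ M}

theorem Meet.map_right {f g : FunSym K} {x y z : M} (h : A.Meet f g x y)
    (hf : Relator.RightUnique (A.map f)) (hz : A.map f x z) : A.map g y z := by
  obtain ⟨z', -, hfz', hgz'⟩ := h
  rwa [hf hz hfz']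

theorem Represents.sym_head? {l : List Γ} {x : M} (h : A.Represents l x) : A.sym l.head? x :=
  match l, h with
  | [], h => h
  | _ :: _, h => h.1

namespace IsTrace

variable [DecidableEq K] {P : StackMachine Q K Γ} {c : Q × (K → List Γ)}

theorem exists_represents_tail (hA : A.IsTrace P c) {k : K} {x y : M}
    (hxy : A.map (.top k) x y) {l : List Γ} (hl : A.Represents l y) :
    ∃ z, A.map (.below k) x z ∧ A.Represents l.tail z := by
  obtain ⟨z, -, hxz, hyz⟩ := hA.below k x y hxy
  refine ⟨z, hxz, ?_⟩
  match l, hl with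
  | [], hl => exact hA.bottom y z hyz hl
  | _ :: _, ⟨_, z', hyz', hl⟩ => rwa [List.tail_cons, hA.rightUnique _ hyz hyz']

theorem exists_represents_apply (hA : A.IsTrace P c) {k : K} {x x' : M} {op : StackOp Γ}
    (hop : A.OpRel k x x' op) {l : List Γ} (hl : ∃ y, A.map (.top k) x y ∧ A.Represents l y) :
    ∃ y, A.map (.top k) x' y ∧ A.Represents (op.apply l) y := by
  obtain ⟨y, hxy, hy⟩ := hl
  cases op with
  | keep => exact ⟨y, hop.map_right (hA.rightUnique _) hxy, hy⟩
  | pop =>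
    obtain ⟨z, hxz, hz⟩ := hA.exists_represents_tail hxy hy
    exact ⟨z, hop.map_right (hA.rightUnique _) hxz, hz⟩
  | push a =>
    obtain ⟨hbelow, z, hx'z, hz⟩ := hop
    have hzy : A.map .next z y :=
      (hA.below k x' z hx'z).map_right (hA.rightUnique _) (hbelow.map_right (hA.rightUnique _) hxy)
    exact ⟨z, hx'z, hz, y, hzy, hy⟩

theorem representsCfg_run_succ (hA : A.IsTrace P c) {n : ℕ} {i : Instruction Q K Γ}
    (hi : P (P.run c n).1 = some i) {x x' : M} (hx : A.RepresentsCfg (P.run c n) x)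
    (hstep : A.map .step x x') : A.RepresentsCfg (P.run c (n + 1)) x' := by
  refine ⟨?_, fun k => ?_⟩
  · obtain ⟨y, hxy, hy⟩ := hx.2 i.stack
    rw [StackMachine.run_succ_fst hi]
    exact hA.control _ i hi _ x x' hstep hx.1 y hxy hy.sym_head?
  · rw [StackMachine.run_succ_snd]
    exact hA.exists_represents_apply (hA.stack _ k x x' hstep hx.1) (hx.2 k)

theorem halts [Finite M] (hA : A.IsTrace P c) : P.Halts c := by
  rw [StackMachine.halts_iff_exists_run]
  by_contra! hrun
  obtain ⟨x₀, hx₀, hprev⟩ := hA.exists_init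
  have hstep (n : ℕ) (x : M) (hx : A.RepresentsCfg (P.run c n) x) :
      ∃ y, A.map .step x y ∧ A.RepresentsCfg (P.run c (n + 1)) y := by
    obtain ⟨i, hi⟩ := Option.ne_none_iff_exists'.1 (hrun n)
    obtain ⟨y, hxy⟩ := hA.progress _ i hi x hx.1
    exact ⟨y, hxy, hA.representsCfg_run_succ hi hx hxy⟩
  choose! succ hsucc using hstep
  let x (n : ℕ) : M := Nat.rec x₀ succ n
  have hx (n : ℕ) : A.RepresentsCfg (P.run c n) (x n) := by
    induction n with
    | zero => exact hx₀
    | succ n ih => exact (hsucc n _ ih).2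
  exact not_injective_infinite_finite x (injective_of_rightUnique (hA.rightUnique .prev) hprev
    fun n => hA.prev_of_step _ _ (hsucc n _ (hx n)).1)

end IsTrace

end Interpretation

/-- A stack cell together with the cells below it, given by the word that they contain. The bit
distinguishes a cell from the one below it, even at the bottom of the stack. -/
abbrev Cell (Γ : Type*) := Bool × List Γ

/-- The cell below the given one. -/
def Cell.tail {Γ : Type*} (z : Cell Γ) : Cell Γ := (!z.1, z.2.tail)

/-- The top cell of a stack after an operation, in terms of the top cell before. -/
def StackOp.applyCell {Γ : Type*} : StackOp Γ → Cell Γ → Cell Γ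
  | keep, z => z
  | pop, z => z.tail
  | push a, z => (!z.1, a :: z.2)

namespace StackMachine

variable {Q K Γ : Type*} [DecidableEq K] (P : StackMachine Q K Γ) (c : Q × (K → List Γ))

/-- The cell on top of the stack `k` of the configuration after `n` steps. -/
def topCell (k : K) : ℕ → Cell Γ
  | 0 => (false, c.2 k)
  | n + 1 => (P.opAt (P.run c n).1 k).applyCell (topCell k n)

/-- The interpretation of the partial functions by the run of a machine. -/
inductive RunMap : FunSym K → ℕ ⊕ Cell Γ → ℕ ⊕ Cell Γ → Prop
  | top (k : K) (n : ℕ) : RunMap (.top k) (.inl n) (.inr (P.topCell c k n))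
  | below (k : K) (n : ℕ) : RunMap (.below k) (.inl n) (.inr (P.topCell c k n).tail)
  | next (z : Cell Γ) : RunMap .next (.inr z) (.inr z.tail)
  | step (n : ℕ) : RunMap .step (.inl n) (.inl (n + 1))
  | prev (n : ℕ) : RunMap .prev (.inl (n + 1)) (.inl n)

/-- The configurations and the stack cells that occur in the first `T` steps of a run. -/
def traceSet (T : ℕ) : Set (ℕ ⊕ Cell Γ) :=
  .inl '' Set.Iic T ∪ .inr '' {z | ∃ n ≤ T, ∃ k, z.2 <:+ (P.run c n).2 k}

/-- The interpretation given by the first `T` steps of a run. -/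
def trace (T : ℕ) : Interpretation Q K Γ (P.traceSet c T) where
  state q x := ∃ n, x.1 = .inl n ∧ (P.run c n).1 = q
  sym o x := ∃ z, x.1 = .inr z ∧ z.2.head? = o
  map f x y := P.RunMap c f x y
  guard _ _ _ := True

variable {P c}

theorem RunMap.rightUnique (f : FunSym K) : Relator.RightUnique (P.RunMap c f) := by
  rintro x y z ⟨⟩ ⟨⟩ <;> rfl

theorem RunMap.ne {f : FunSym K} {x y : ℕ ⊕ Cell Γ} (h : P.RunMap c f x y) : x ≠ y := by
  have htail (z : Cell Γ) : z ≠ z.tail := fun hz => by simpa [Cell.tail] using congrArg Prod.fst hz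
  cases h <;> simp [htail]

theorem finite_traceSet [Finite K] (T : ℕ) : (P.traceSet c T).Finite := by
  refine ((Set.finite_Iic T).image _).union (.image _ ?_)
  have hwords : (⋃ n ∈ Set.Iic T, ⋃ k, {l | l <:+ (P.run c n).2 k}).Finite := by
    refine (Set.finite_Iic T).biUnion fun n _ => Set.finite_iUnion fun k => ?_
    simpa only [← List.mem_tails] using List.finite_toSet _
  refine (Set.finite_univ.prod hwords).subset fun z ⟨n, hn, k, hz⟩ => ⟨trivial, ?_⟩
  simp only [Set.mem_iUnion]
  exact ⟨n, hn, k, hz⟩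

theorem topCell_snd (k : K) (n : ℕ) : (P.topCell c k n).2 = (P.run c n).2 k := by
  induction n with
  | zero => rfl
  | succ n ih =>
    rw [run_succ_snd, topCell, ← ih]
    cases P.opAt (P.run c n).1 k <;> rfl

theorem inl_mem_traceSet {T n : ℕ} : .inl n ∈ P.traceSet c T ↔ n ≤ T := by
  simp [traceSet]

theorem topCell_mem_traceSet {T n : ℕ} (hn : .inl n ∈ P.traceSet c T) (k : K) :
    .inr (P.topCell c k n) ∈ P.traceSet c T :=
  .inr ⟨_, ⟨n, inl_mem_traceSet.1 hn, k, by rw [topCell_snd]⟩, rfl⟩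

theorem tail_mem_traceSet {T : ℕ} {z : Cell Γ} (hz : .inr z ∈ P.traceSet c T) :
    .inr z.tail ∈ P.traceSet c T := by
  obtain ⟨_, -, ⟨⟩⟩ | ⟨_, ⟨n, hn, k, hz⟩, ⟨⟩⟩ := hz
  exact .inr ⟨_, ⟨n, hn, k, (List.tail_suffix _).trans hz⟩, rfl⟩

theorem represents_trace {T : ℕ} {l : List Γ} {x : P.traceSet c T} {b : Bool}
    (hx : x.1 = .inr (b, l)) : (P.trace c T).Represents l x := by
  induction l generalizing x b with
  | nil => exact ⟨_, hx, rfl⟩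
  | cons a l ih =>
    obtain ⟨_, hmem⟩ := x
    subst hx
    exact ⟨⟨_, rfl, rfl⟩, ⟨_, tail_mem_traceSet hmem⟩, .next _, ih rfl⟩

theorem opRel_trace {T n : ℕ} {k : K} (hn : .inl n ∈ P.traceSet c T)
    (hn' : .inl (n + 1) ∈ P.traceSet c T) {op : StackOp Γ}
    (hop : P.topCell c k (n + 1) = op.applyCell (P.topCell c k n)) :
    (P.trace c T).OpRel k ⟨_, hn⟩ ⟨_, hn'⟩ op := by
  have hmem := topCell_mem_traceSet hn k
  have hmem' := topCell_mem_traceSet hn' k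
  have htop' := RunMap.top (P := P) (c := c) k (n + 1)
  have hbelow' := RunMap.below (P := P) (c := c) k (n + 1)
  rw [hop] at hmem' htop' hbelow'
  cases op with
  | keep => exact ⟨⟨_, hmem⟩, trivial, .top k n, htop'⟩
  | pop => exact ⟨⟨_, tail_mem_traceSet hmem⟩, trivial, .below k n, htop'⟩
  | push a =>
    have htail : ((StackOp.push a).applyCell (P.topCell c k n)).tail = P.topCell c k n := by
      simp [StackOp.applyCell, Cell.tail]
    rw [htail] at hbelow'
    exact ⟨⟨⟨_, hmem⟩, trivial, .top k n, hbelow'⟩, ⟨_, hmem'⟩, htop', _, rfl, rfl⟩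

theorem isTrace_trace {T : ℕ} (hT : P (P.run c T).1 = none) : (P.trace c T).IsTrace P c where
  rightUnique f _ _ _ hy hz := Subtype.ext (RunMap.rightUnique f hy hz)
  below := by
    rintro k ⟨_, hx⟩ ⟨_, hy⟩ ⟨_, n⟩
    exact ⟨⟨_, tail_mem_traceSet hy⟩, trivial, .below k n, .next _⟩
  bottom := by
    rintro ⟨_, hx⟩ ⟨_, hy⟩ ⟨⟩ ⟨_, ⟨⟩, hz⟩
    rw [List.head?_eq_none_iff] at hz
    exact ⟨_, rfl, by simp [Cell.tail, hz]⟩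
  prev_of_step := by
    rintro ⟨_, hx⟩ ⟨_, hy⟩ ⟨_⟩
    exact .prev _
  progress := by
    rintro _ i hi ⟨_, hx⟩ ⟨n, rfl, rfl⟩
    have hn : n ≠ T := by
      rintro rfl
      simp [hT] at hi
    rw [inl_mem_traceSet] at hx
    exact ⟨⟨_, inl_mem_traceSet.2 (Nat.lt_of_le_of_ne hx hn)⟩, .step n⟩
  control := by
    rintro _ i hi o ⟨_, hx⟩ ⟨_, hy⟩ ⟨_⟩ ⟨_, ⟨⟩, rfl⟩ ⟨_, hz⟩ ⟨⟩ ⟨_, ⟨⟩, rfl⟩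
    exact ⟨_, rfl, by rw [run_succ_fst hi, topCell_snd]⟩
  stack := by
    rintro _ k ⟨_, hx⟩ ⟨_, hy⟩ ⟨_⟩ ⟨_, ⟨⟩, rfl⟩
    exact opRel_trace hx hy rfl
  exists_init := by
    have h0 : .inl 0 ∈ P.traceSet c T := inl_mem_traceSet.2 T.zero_le
    refine ⟨⟨_, h0⟩, ⟨⟨0, rfl, rfl⟩, fun k =>
      ⟨⟨_, topCell_mem_traceSet h0 k⟩, .top k 0, represents_trace rfl⟩⟩, ?_⟩
    rintro _ ⟨⟩

end StackMachine

namespace Interpretation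

variable {Q K Γ : Type*} [Finite Q] [Finite K] [Finite Γ] {M : Type}

/-- The structure that encodes an interpretation. -/
abbrev toStructure (A : Interpretation Q K Γ M) : relLang.Structure M where
  funMap f := f.elim
  RelMap {n} r := match n with
    | 1 => fun v => (∃ q : Q, r = 2 * index q ∧ A.state q (v 0)) ∨
        ∃ o : Option Γ, r = 2 * index o + 1 ∧ A.sym o (v 0)
    | 2 => fun v => ∃ f : FunSym K, r = index f ∧
        (A.map f (v 0) (v 1) ∨ v 0 = v 1 ∧ ∃ z, A.map f (v 0) z)
    | 3 => fun v => A.guard (v 0) (v 1) (v 2)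
    | _ => fun _ => False

theorem edgeRel_toStructure (A : Interpretation Q K Γ M) (f : FunSym K) (x y : M) :
    let := A.toStructure
    edgeRel M f x y ↔ A.map f x y ∨ x = y ∧ ∃ z, A.map f x z := by
  let := A.toStructure
  simp [edgeRel, Language.Structure.RelMap, index_injective.eq_iff]

theorem interp_toStructure (A : Interpretation Q K Γ M) (hirrefl : ∀ f x, ¬ A.map f x x) :
    let := A.toStructure
    interp Q K Γ M = A := by
  let := A.toStructure
  have hparity (m n : ℕ) : 2 * m ≠ 2 * n + 1 := by omega
  ext q x
  · simp [interp, Language.Structure.RelMap, index_injective.eq_iff, hparity]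
  · simp [interp, Language.Structure.RelMap, index_injective.eq_iff, (hparity _ _).symm]
  · simp only [interp, edgeRel_toStructure]
    grind
  · rfl

end Interpretation

theorem finSat_haltSentence_iff {Q K : Type*} {Γ : Type} [Finite Q] [Finite K] [Finite Γ]
    [DecidableEq K] {P : StackMachine Q K Γ} {c : Q × (K → List Γ)} :
    (haltSentence P c).FinSat ↔ P.Halts c := by
  constructor
  · rintro ⟨M, ⟨x⟩, _, _, h⟩
    exact ((sat_haltSentence P c fun _ => x).1 (h _)).2.halts
  · intro h
    obtain ⟨T, hT⟩ := StackMachine.halts_iff_exists_run.1 h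
    have htrace := StackMachine.isTrace_trace hT
    have hirrefl (f : FunSym K) (x) : ¬ (P.trace c T).map f x x :=
      fun hx => hx.ne rfl
    have hfinite := (StackMachine.finite_traceSet (P := P) (c := c) T).to_subtype
    let := (P.trace c T).toStructure
    refine ⟨P.traceSet c T, ⟨htrace.exists_init.choose⟩, hfinite, this, fun s => ?_⟩
    rw [sat_haltSentence, Interpretation.interp_toStructure _ hirrefl]
    refine ⟨fun f => ?_, htrace⟩
    have henc := encodesPartialFun_or_eq (htrace.rightUnique f) (hirrefl f)
    simpa only [← Interpretation.edgeRel_toStructure] using henc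

theorem primrec_natPair_const {f : ℕ → ℕ} (hf : Primrec f) (n : ℕ) :
    Primrec fun m => Nat.pair n (f m) :=
  Primrec₂.natPair.comp (.const n) hf

/-- The Gödel number of `F x` is a primitive recursive function of `e x`. With `e = id` this
concerns sequences of formulae, and with `e = code` operations on formulae. -/
def IsPrimrecIn {α : Type*} (e : α → ℕ) (F : α → Formula) : Prop :=
  ∃ g, Primrec g ∧ ∀ x, (F x).code = g (e x)

namespace IsPrimrecIn

variable {α : Type*} {e : α → ℕ} {F G : α → Formula}

theorem const (e : α → ℕ) (φ : Formula) : IsPrimrecIn e fun _ => φ :=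
  ⟨_, .const φ.code, fun _ => rfl⟩

theorem and (hF : IsPrimrecIn e F) (hG : IsPrimrecIn e G) :
    IsPrimrecIn e fun x => (F x).and (G x) := by
  obtain ⟨f, hf, hFf⟩ := hF
  obtain ⟨g, hg, hGg⟩ := hG
  exact ⟨_, primrec_natPair_const (Primrec₂.natPair.comp hf hg) 3, fun x => by rw [code, hFf, hGg]⟩

theorem exBlock (hF : IsPrimrecIn e F) (y : ℕ) : IsPrimrecIn e fun x => exBlock [y] (F x) := by
  obtain ⟨f, hf, hFf⟩ := hF
  exact ⟨_, primrec_natPair_const (primrec_natPair_const hf y) 7, fun x => by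
    simp [Formula.exBlock, code, hFf]⟩

theorem wit {K : Type*} [Finite K] (hF : IsPrimrecIn e F) (f : FunSym K) (x y : ℕ) :
    IsPrimrecIn e fun a => wit f x y (F a) :=
  .exBlock (.and (.const e _) (.and (.const e _) hF)) y

theorem conj {ι : Type*} [Finite ι] {F : α → ι → Formula}
    (hF : ∀ i, IsPrimrecIn e fun x => F x i) : IsPrimrecIn e fun x => conj (F x) := by
  have hfoldr (l : List ι) :
      IsPrimrecIn e fun x => (l.map (F x)).foldr Formula.and PercLogic.verum := by
    induction l with
    | nil => exact .const e _
    | cons i l ih => exact .and (hF i) ih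
  simpa only [PercLogic.conj, List.map_ofFn] using hfoldr (List.ofFn (Finite.equivFin ι).symm)

theorem iterate {T : Formula → Formula} (hT : IsPrimrecIn code T) (φ : Formula) :
    IsPrimrecIn id fun n => T^[n] φ := by
  obtain ⟨g, hg, hTg⟩ := hT
  refine ⟨_, Primrec.nat_rec₁ φ.code (hg.comp Primrec.snd).to₂, fun n => ?_⟩
  induction n with
  | zero => rfl
  | succ n ih =>
    exact (congrArg code (Function.iterate_succ_apply' T n φ)).trans ((hTg _).trans (congrArg g ih))

variable {Q K Γ : Type*} [Finite Q] [Finite K] [Finite Γ]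

theorem content_replicate_append (a : Γ) (l : List Γ) :
    IsPrimrecIn id fun m => content K (List.replicate m a ++ l) := by
  have hcons : IsPrimrecIn code (contentCons K a) :=
    .and (.const _ _) (.wit (.exBlock (.and (.const _ _) ⟨id, .id, fun _ => rfl⟩) 1) .next 1 0)
  have hiterate (m : ℕ) :
      (contentCons K a)^[m] (content K l) = content K (List.replicate m a ++ l) := by
    induction m with
    | zero => rfl
    | succ m ih =>
      rw [Function.iterate_succ_apply', ih, List.replicate_succ, List.cons_append, content]
  simpa only [hiterate] using hcons.iterate (content K l)

theorem haltSentence_replicate_append [DecidableEq K] (P : StackMachine Q K Γ) (q₀ : Q) (k₀ : K)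
    (a : Γ) (l : List Γ) : IsPrimrecIn id fun m =>
      haltSentence P (q₀, Function.update (fun _ => []) k₀ (List.replicate m a ++ l)) := by
  simp only [haltSentence, initSentence]
  refine .and (.const _ _) (.exBlock (.and (.const _ _) (.and (.const _ _) (.conj fun k => ?_))) 0)
  refine .wit ?_ (.top k) 0 1
  obtain rfl | hk := eq_or_ne k k₀
  · simpa only [Function.update_self] using content_replicate_append a l
  · simpa only [Function.update_of_ne hk] using const id (content K [])

end IsPrimrecIn

theorem FinSatDecidable.mono {C D : Set Formula} (h : FinSatDecidable D) (hCD : C ⊆ D) :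
    FinSatDecidable C := by
  obtain ⟨f, hf, hfD⟩ := h
  exact ⟨f, hf, fun φ hφ => hfD φ (hCD hφ)⟩

theorem not_finSatDecidable_setOf_isTernaryOn : ¬ FinSatDecidable {φ | IsTernaryOn ∅ φ} := by
  rintro ⟨f, hf, hfsat⟩
  obtain ⟨Q, K, Γ, _, _, _, _, P, q₀, k₀, a, e, hP⟩ :=
    StackMachine.exists_halts_iff_halting_problem
  obtain ⟨g, hg, hcode⟩ := IsPrimrecIn.haltSentence_replicate_append P q₀ k₀ a [e]
  refine ComputablePred.halting_problem 0 (ComputablePred.computable_iff.2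
    ⟨fun c => f (g (Encodable.encode c)), hf.comp (hg.to_comp.comp Computable.encode), ?_⟩)
  funext c
  have h := hfsat _ (IsTernaryOn.haltSentence P
    (q₀, Function.update (fun _ => []) k₀ (List.replicate (Encodable.encode c) a ++ [e])))
  rw [finSat_haltSentence_iff, hP, Denumerable.ofNat_encode, hcode] at h
  exact propext h.symm

end PercLogic

theorem mainTheorem4 :
    ¬ PercLogic.FinSatDecidable PercLogic.GFLocSentences ∧
    ¬ PercLogic.FinSatDecidable
      {φ | φ ∈ PercLogic.GFLocVarSentences 3 ∧ φ.ArityLE 3} := by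
  refine ⟨fun h => PercLogic.not_finSatDecidable_setOf_isTernaryOn (h.mono fun φ hφ => ?_),
    fun h => PercLogic.not_finSatDecidable_setOf_isTernaryOn (h.mono fun φ hφ => ?_)⟩
  · exact ⟨hφ.gfLoc, Finset.subset_empty.1 hφ.free_subset⟩
  · exact ⟨⟨⟨hφ.gfLoc, Finset.subset_empty.1 hφ.free_subset⟩, hφ.vars_lt⟩, hφ.arityLE⟩
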